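/- Let $n\ge 2$ be an integer. For a word $w$ over the ordered alphabet $\mathcal{A}_n=\{1<2<\cdots<n\}$, let $P_{\mathrm{R}}(w)$ be the labelled binary tree obtained by reading $w$ from right to left and inserting its letters one after another, starting from the empty tree, by the following rule: a letter $a$ inserted into the empty tree creates a node labelled $a$; a letter $a$ inserted into a tree with root label $x$ is inserted recursively into the right subtree if $a>x$ and into the left subtree otherwise. Let $P_{\mathrm{L}}(w)$ be the labelled binary tree obtained by reading $w$ from left to right and inserting its letters by the rule in which $a$ goes to the left subtree if $a<x$ and to the right subtree otherwise. The relation $u\equiv v \iff (P_{\mathrm{L}}(u),P_{\mathrm{R}}(u))=(P_{\mathrm{L}}(v),P_{\mathrm{R}}(v))$ is a congruence on the free monoid $\mathcal{A}_n^{\star}$; the Baxter monoid of rank $n$ is the quotient $\mathsf{baxt}_n=\mathcal{A}_n^{\star}/{\equiv}$. Schützenberger's involution $^\sharp$ on $\mathsf{baxt}_n$ is induced by the map $w_1w_2\cdots w_k\mapsto w_k^{\sharp}\cdots w_2^{\sharp}w_1^{\sharp}$ on words, where $a^{\sharp}=n+1-a$ for $a\in\mathcal{A}_n$. An involution semigroup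 is a nonempty semigroup with a unary operation $^*$ such that $(x^*)^*=x$ and $(xy)^*=y^*x^*$. A variety of involution semigroups is a class of involution semigroups closed under homomorphic images, subalgebras and direct products (with respect to the operations $\cdot$ and $^*$), and the variety generated by an involution semigroup is the smallest variety containing it. **Theorem.** For each integer $n\ge 2$, the variety of involution semigroups generated by $(\mathsf{baxt}_n,{}^{\sharp})$ contains continuum many subvarieties, that is, the set of varieties contained in it has cardinality exactly $2^{\aleph_0}$. -/

import Mathlib

/-! ### The Baxter monoid of rank `n` -/

namespace Baxter

/-- Insertion of a symbol into a right strict binary search tree: symbols greater than the root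
label go to the right subtree, all other symbols go to the left subtree. -/
def rightStrictInsert {α : Type} [LinearOrder α] (a : α) : BinaryTree α → BinaryTree α
  | .nil => .node a .nil .nil
  | .node x l r =>
      if x < a then .node x l (rightStrictInsert a r) else .node x (rightStrictInsert a l) r

/-- Insertion of a symbol into a left strict binary search tree: symbols smaller than the root
label go to the left subtree, all other symbols go to the right subtree. -/
def leftStrictInsert {α : Type} [LinearOrder α] (a : α) : BinaryTree α → BinaryTree α
  | .nil => .node a .nil .nil
  | .node x l r =>
      if a < x then .node x (leftStrictInsert a l) r else .node x l (leftStrictInsert a r)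

/-- The right strict binary search tree of a word, which is read from right to left. -/
def rightTree {α : Type} [LinearOrder α] (w : List α) : BinaryTree α :=
  w.foldr rightStrictInsert .nil

/-- The left strict binary search tree of a word, which is read from left to right. -/
def leftTree {α : Type} [LinearOrder α] (w : List α) : BinaryTree α :=
  w.foldl (fun T a => leftStrictInsert a T) .nil

/-- The pair of twin binary search trees of a word. -/
def twinTrees {α : Type} [LinearOrder α] (w : List α) : BinaryTree α × BinaryTree α :=
  (leftTree w, rightTree w)

/-- Reverse a word and apply the order-reversing permutation of the alphabet to its letters. -/
def sharp {n : ℕ} (w : List (Fin n)) : List (Fin n) := (w.map Fin.rev).reverse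

/-! Facts showing that having the same twin binary search trees is a congruence compatible with
`sharp`. -/

/-- The part of a search tree with labels at most `x`. -/
def lower {α : Type} [LinearOrder α] (x : α) : BinaryTree α → BinaryTree α
  | .nil => .nil
  | .node y l r => if x < y then lower x l else .node y l (lower x r)

/-- The part of a search tree with labels greater than `x`. -/
def upper {α : Type} [LinearOrder α] (x : α) : BinaryTree α → BinaryTree α
  | .nil => .nil
  | .node y l r => if x < y then .node y (upper x l) r else upper x r

theorem lower_insert {α : Type} [LinearOrder α] (x a : α) (T : BinaryTree α) :
    lower x (rightStrictInsert a T) =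
      if x < a then lower x T else rightStrictInsert a (lower x T) := by
  induction T with
  | nil => by_cases h : x < a <;> simp [rightStrictInsert, lower, h]
  | node y l r ihl ihr =>
    rcases lt_or_ge y a with h1 | h1 <;> rcases lt_or_ge x y with h2 | h2 <;>
      rcases lt_or_ge x a with h3 | h3 <;>
      first
        | (exfalso; order)
        | simp [rightStrictInsert, lower, h1, h2, h3, h1.not_gt, h2.not_gt, h3.not_gt, ihl, ihr]

theorem upper_insert {α : Type} [LinearOrder α] (x a : α) (T : BinaryTree α) :
    upper x (rightStrictInsert a T) =
      if x < a then rightStrictInsert a (upper x T) else upper x T := by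
  induction T with
  | nil => by_cases h : x < a <;> simp [rightStrictInsert, upper, h]
  | node y l r ihl ihr =>
    rcases lt_or_ge y a with h1 | h1 <;> rcases lt_or_ge x y with h2 | h2 <;>
      rcases lt_or_ge x a with h3 | h3 <;>
      first
        | (exfalso; order)
        | simp [rightStrictInsert, upper, h1, h2, h3, h1.not_gt, h2.not_gt, h3.not_gt, ihl, ihr]

/-- Mirror image of a tree, with the order of the labels reversed. -/
def mirror {n : ℕ} : BinaryTree (Fin n) → BinaryTree (Fin n)
  | .nil => .nil
  | .node x l r => .node x.rev (mirror r) (mirror l)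

theorem mirror_mirror {n : ℕ} (T : BinaryTree (Fin n)) : mirror (mirror T) = T := by
  induction T with
  | nil => rfl
  | node x l r ihl ihr => simp [mirror, ihl, ihr]

theorem mirror_leftStrictInsert {n : ℕ} (a : Fin n) (T : BinaryTree (Fin n)) :
    mirror (leftStrictInsert a T) = rightStrictInsert a.rev (mirror T) := by
  induction T with
  | nil => rfl
  | node x l r ihl ihr =>
    by_cases h : a < x <;> simp [leftStrictInsert, rightStrictInsert, mirror, h, ihl, ihr]

theorem rightTree_filter_le {α : Type} [LinearOrder α] (x : α) (w : List α) :
    rightTree (w.filter fun a => ¬ x < a) = lower x (rightTree w) := by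
  induction w with
  | nil => rfl
  | cons a w ih =>
    have h : rightTree (a :: w) = rightStrictInsert a (rightTree w) := rfl
    rw [h, lower_insert, ← ih]
    by_cases h3 : x < a
    · simp [h3]
    · simp only [h3, not_false_eq_true, decide_true, List.filter_cons_of_pos, if_false]
      rfl

theorem rightTree_filter_gt {α : Type} [LinearOrder α] (x : α) (w : List α) :
    rightTree (w.filter fun a => x < a) = upper x (rightTree w) := by
  induction w with
  | nil => rfl
  | cons a w ih =>
    have h : rightTree (a :: w) = rightStrictInsert a (rightTree w) := rfl
    rw [h, upper_insert, ← ih]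
    by_cases h3 : x < a
    · simp only [h3, decide_true, List.filter_cons_of_pos, if_true]
      rfl
    · simp [h3]

theorem foldr_insert_node {α : Type} [LinearOrder α] (x : α) (l r : BinaryTree α) (w : List α) :
    w.foldr rightStrictInsert (BinaryTree.node x l r) =
      BinaryTree.node x ((w.filter fun a => ¬ x < a).foldr rightStrictInsert l)
        ((w.filter fun a => x < a).foldr rightStrictInsert r) := by
  induction w with
  | nil => rfl
  | cons a w ih =>
    by_cases h : x < a <;> simp_all [rightStrictInsert]

theorem foldr_insert_congr {α : Type} [LinearOrder α] (T : BinaryTree α) {u v : List α}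
    (h : rightTree u = rightTree v) :
    u.foldr rightStrictInsert T = v.foldr rightStrictInsert T := by
  induction T generalizing u v with
  | nil => exact h
  | node x l r ihl ihr =>
    rw [foldr_insert_node, foldr_insert_node, ihl (v := v.filter fun a => ¬ x < a),
      ihr (v := v.filter fun a => x < a)]
    · rw [rightTree_filter_gt, rightTree_filter_gt, h]
    · rw [rightTree_filter_le, rightTree_filter_le, h]

theorem rightTree_append {α : Type} [LinearOrder α] {u u' v v' : List α}
    (hu : rightTree u = rightTree u') (hv : rightTree v = rightTree v') :
    rightTree (u ++ v) = rightTree (u' ++ v') := by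
  have h : ∀ a b : List α, rightTree (a ++ b) = a.foldr rightStrictInsert (rightTree b) :=
    fun a b => by simp [rightTree]
  rw [h, h, hv]
  exact foldr_insert_congr _ hu

theorem sharp_append {n : ℕ} (u v : List (Fin n)) : sharp (u ++ v) = sharp v ++ sharp u := by
  simp [sharp]

theorem sharp_sharp {n : ℕ} (u : List (Fin n)) : sharp (sharp u) = u := by
  simp [sharp, Function.comp_def]

theorem mirror_leftTree {n : ℕ} (w : List (Fin n)) :
    mirror (leftTree w) = rightTree (sharp w) := by
  induction w using List.reverseRecOn with
  | nil => rfl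
  | append_singleton w a ih =>
    have h1 : leftTree (w ++ [a]) = leftStrictInsert a (leftTree w) := by simp [leftTree]
    have h2 : rightTree (sharp (w ++ [a])) =
        rightStrictInsert a.rev (rightTree (sharp w)) := by simp [rightTree, sharp]
    rw [h1, h2, mirror_leftStrictInsert, ih]

theorem leftTree_eq_iff {n : ℕ} (u v : List (Fin n)) :
    leftTree u = leftTree v ↔ rightTree (sharp u) = rightTree (sharp v) := by
  rw [← mirror_leftTree, ← mirror_leftTree]
  exact ⟨fun h => by rw [h], fun h => by
    rw [← mirror_mirror (leftTree u), h, mirror_mirror]⟩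

theorem twinTrees_append {n : ℕ} {u u' v v' : List (Fin n)}
    (hu : twinTrees u = twinTrees u') (hv : twinTrees v = twinTrees v') :
    twinTrees (u ++ v) = twinTrees (u' ++ v') := by
  simp only [twinTrees, Prod.mk.injEq, leftTree_eq_iff, sharp_append] at *
  exact ⟨rightTree_append hv.1 hu.1, rightTree_append hu.2 hv.2⟩

theorem twinTrees_sharp {n : ℕ} {u v : List (Fin n)} (h : twinTrees u = twinTrees v) :
    twinTrees (sharp u) = twinTrees (sharp v) := by
  simp only [twinTrees, Prod.mk.injEq, leftTree_eq_iff, sharp_sharp] at *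
  exact ⟨h.2, h.1⟩

/-- The Baxter congruence on the free monoid over the ordered alphabet with `n` letters. -/
def con (n : ℕ) : Con (FreeMonoid (Fin n)) where
  r u v := twinTrees u.toList = twinTrees v.toList
  iseqv := ⟨fun _ => rfl, fun h => h.symm, fun h h' => h.trans h'⟩
  mul' h h' := by
    simp only [FreeMonoid.toList_mul]
    exact twinTrees_append h h'

/-- The Baxter monoid of rank `n`. -/
abbrev BaxterMonoid (n : ℕ) : Type := (con n).Quotient

/-- Schützenberger's involution on the Baxter monoid: on words it reverses the word and applies
the order-reversing permutation to the letters. -/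
instance (n : ℕ) : StarMul (BaxterMonoid n) where
  star := Quotient.map (fun w => FreeMonoid.ofList (sharp w.toList))
    (fun _ _ h => twinTrees_sharp h)
  star_involutive a := Con.induction_on a fun w =>
    congrArg (fun w : FreeMonoid (Fin n) => (w : BaxterMonoid n)) (sharp_sharp w)
  star_mul a b := Con.induction_on₂ a b fun u v =>
    congrArg (fun w : FreeMonoid (Fin n) => (w : BaxterMonoid n)) (sharp_append u v)

end Baxter

/-! ### Varieties of involution semigroups -/

/-- An involution semigroup: a nonempty semigroup with a unary operation `star` that satisfies
`star (star x) = x` and `star (x * y) = star y * star x`. -/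
structure InvSemigroup : Type 1 where
  carrier : Type
  [nonempty : Nonempty carrier]
  [semigroup : Semigroup carrier]
  [starMul : StarMul carrier]

namespace InvSemigroup

instance : CoeSort InvSemigroup Type := ⟨carrier⟩

attribute [instance] InvSemigroup.nonempty InvSemigroup.semigroup InvSemigroup.starMul

/-- Homomorphisms of involution semigroups. -/
structure Hom (A B : InvSemigroup) where
  toFun : A → B
  map_mul : ∀ x y, toFun (x * y) = toFun x * toFun y
  map_star : ∀ x, toFun (star x) = star (toFun x)

/-- The direct product of a family of involution semigroups, with componentwise operations. -/
def pi {ι : Type} (A : ι → InvSemigroup) : InvSemigroup := ⟨∀ i, A i⟩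

/-- A variety: a class of involution semigroups closed under homomorphic images, subalgebras
(up to isomorphism) and direct products. -/
structure IsVariety (V : Set InvSemigroup) : Prop where
  image : ∀ (A B : InvSemigroup) (f : Hom A B), Function.Surjective f.toFun → A ∈ V → B ∈ V
  sub : ∀ (A B : InvSemigroup) (f : Hom A B), Function.Injective f.toFun → B ∈ V → A ∈ V
  prod : ∀ (ι : Type) (A : ι → InvSemigroup), (∀ i, A i ∈ V) → pi A ∈ V

/-- The variety generated by `S`: the smallest variety that contains `S`. -/
def generatedVariety (S : InvSemigroup) : Set InvSemigroup :=
  ⋂₀ {V | IsVariety V ∧ S ∈ V}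

end InvSemigroup

/-- The Baxter monoid of rank `n` with Schützenberger's involution, as an involution semigroup. -/
def baxt (n : ℕ) : InvSemigroup := ⟨Baxter.BaxterMonoid n⟩

/-! Upper bound: by Birkhoff's theorem a variety is determined by its identities in countably many
variables, and there are only countably many pairs of such terms, hence at most continuum many
varieties. Lower bound: it suffices to find algebras `A k` in the variety and identities such that
`A j` violates exactly the `j`-th one; every set of indices then gives its own subvariety
(`continuum_le_mk_isVariety`). The identities are `w ≈ w * w` for the words `w = 0 1 ⋯ (k-1) 0 (k-1)
⋯ 1`, `3 ≤ k`, and the algebras are the Rees quotients `rees k` of the free involution semigroup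
whose nonzero elements are the factors of `w` and their stars. Membership of `rees k` holds because
every factor of `w` is an isoterm for the Baxter monoid (`Baxter.eq_of_satisfies`): letters occur at
most twice, a word is determined by its projections to pairs of letters, and a binary word with at
most two occurrences of each letter is determined by its twin trees for the two orders of the
alphabet. Independence is combinatorial: if a substitution maps the `k`-th word to a factor of the
`j`-th one, each letter, occurring twice, must go to a single letter, since no factor of length two
repeats. The image is then a factor in which every letter recurs, and only the whole `j`-th word is
such a factor, so the lengths agree and `j = k` (`PairedWord.Paired.length_eq_of_flatMap`). -/

/-! ### Terms, identities, Birkhoff's theorem and the number of subvarieties -/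

namespace InvSemigroup

/-- Terms in the variables `X`: elements of the free involution semigroup on `X`. The letter
`(x, false)` stands for `x` and the letter `(x, true)` for its star. -/
abbrev Term (X : Type) : Type := FreeSemigroup (X × Bool)

/-- The variable `x` or its star. -/
def starLetter {X : Type} (p : X × Bool) : X × Bool := (p.1, !p.2)

/-- The anti-endomorphism of the free semigroup that underlies the star. -/
def starHom (X : Type) : Term X →ₙ* (Term X)ᵐᵒᵖ :=
  FreeSemigroup.lift fun p => MulOpposite.op (FreeSemigroup.of (starLetter p))

instance termStarMul (X : Type) : StarMul (Term X) where
  star u := (starHom X u).unop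
  star_involutive u := by
    induction u using FreeSemigroup.recOnMul with
    | ih1 p => simp [starHom, starLetter]
    | ih2 p u h1 h2 => simp_all [starHom]
  star_mul u v := by simp [starHom]

/-- The value of a letter under an assignment. -/
def letterVal {X : Type} {A : InvSemigroup} (θ : X → A) (p : X × Bool) : A :=
  if p.2 then star (θ p.1) else θ p.1

/-- The value of a term under an assignment. -/
def eval {X : Type} {A : InvSemigroup} (θ : X → A) : Term X →ₙ* A :=
  FreeSemigroup.lift (letterVal θ)

theorem eval_of {X : Type} {A : InvSemigroup} (θ : X → A) (p : X × Bool) :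
    eval θ (FreeSemigroup.of p) = letterVal θ p := rfl

theorem letterVal_starLetter {X : Type} {A : InvSemigroup} (θ : X → A) (p : X × Bool) :
    letterVal θ (starLetter p) = star (letterVal θ p) := by
  rcases p with ⟨x, _ | _⟩ <;> simp [letterVal, starLetter]

theorem eval_star {X : Type} {A : InvSemigroup} (θ : X → A) (u : Term X) :
    eval θ (star u) = star (eval θ u) := by
  induction u using FreeSemigroup.recOnMul with
  | ih1 p => exact letterVal_starLetter θ p
  | ih2 p u h1 h2 => simp only [star_mul, map_mul, h1, h2]

theorem Hom.eval {X : Type} {A B : InvSemigroup} (f : Hom A B) (θ : X → A) (u : Term X) :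
    f.toFun (eval θ u) = InvSemigroup.eval (f.toFun ∘ θ) u := by
  have h (p : X × Bool) : f.toFun (letterVal θ p) = letterVal (f.toFun ∘ θ) p := by
    rcases p with ⟨x, _ | _⟩ <;> simp [letterVal, f.map_star]
  induction u using FreeSemigroup.recOnMul with
  | ih1 p => exact h p
  | ih2 p u h1 h2 => rw [_root_.map_mul, _root_.map_mul, f.map_mul, h1, h2]

/-- The free involution semigroup. -/
abbrev free (X : Type) [Nonempty X] : InvSemigroup :=
  haveI : Nonempty (Term X) := ⟨FreeSemigroup.of (Classical.arbitrary X, false)⟩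
  ⟨Term X⟩

/-- Evaluation as a homomorphism of involution semigroups. -/
def evalHom {X : Type} [Nonempty X] {A : InvSemigroup} (θ : X → A) : Hom (free X) A where
  toFun := eval θ
  map_mul := map_mul (eval θ)
  map_star := eval_star θ

theorem eval_comp_eval {X Y : Type} [Nonempty Y] {A : InvSemigroup} (φ : X → Term Y) (θ : Y → A)
    (u : Term X) : eval θ (eval (A := free Y) φ u) = eval (fun x => eval θ (φ x)) u :=
  (evalHom θ).eval φ u

/-- The identity `u ≈ v` holds in `A`. -/
def Satisfies {X : Type} (A : InvSemigroup) (u v : Term X) : Prop :=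
  ∀ θ : X → A, eval θ u = eval θ v

theorem eval_pi {X ι : Type} (A : ι → InvSemigroup) (θ : X → pi A) (u : Term X) (i : ι) :
    (eval θ u : ∀ i, A i) i = eval (fun x => (θ x : ∀ i, A i) i) u :=
  Hom.eval (A := pi A) ⟨fun x => (x : ∀ i, A i) i, fun _ _ => rfl, fun _ => rfl⟩ θ u

theorem isVariety_satisfies {X : Type} (u v : Term X) : IsVariety {A | Satisfies A u v} where
  image A B f hf hA θ := by
    have h : f.toFun ∘ (fun x => (hf (θ x)).choose) = θ :=
      funext fun x => (hf (θ x)).choose_spec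
    rw [← h, ← f.eval, ← f.eval, hA]
  sub A B f hf hB θ := hf (by rw [f.eval, f.eval, hB])
  prod ι A hA θ := by
    refine funext fun i => ?_
    rw [eval_pi, eval_pi, hA]

theorem IsVariety.sInter {S : Set (Set InvSemigroup)} (h : ∀ V ∈ S, IsVariety V) :
    IsVariety (⋂₀ S) where
  image A B f hf hA V hV := (h V hV).image A B f hf (hA V hV)
  sub A B f hf hB V hV := (h V hV).sub A B f hf (hB V hV)
  prod ι A hA V hV := (h V hV).prod ι A fun i => hA i V hV

theorem isVariety_generatedVariety (S : InvSemigroup) : IsVariety (generatedVariety S) :=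
  IsVariety.sInter fun _ h => h.1

theorem mem_generatedVariety (S : InvSemigroup) : S ∈ generatedVariety S := fun _ h => h.2

/-- The quotient of an involution semigroup by a congruence. -/
def quotient (A : InvSemigroup) (c : Con A) (hc : ∀ x y, c x y → c (star x) (star y)) :
    InvSemigroup where
  carrier := c.Quotient
  nonempty := ⟨(Classical.arbitrary A : A)⟩
  starMul :=
    { star := Quotient.map star hc
      star_involutive := fun a => Con.induction_on a fun x =>
        congrArg (fun x : A => (x : c.Quotient)) (star_star x)
      star_mul := fun a b => Con.induction_on₂ a b fun x y =>
        congrArg (fun x : A => (x : c.Quotient)) (star_mul x y) }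

/-- The projection onto a quotient. -/
def quotientHom (A : InvSemigroup) (c : Con A) (hc : ∀ x y, c x y → c (star x) (star y)) :
    Hom A (quotient A c hc) where
  toFun x := (x : c.Quotient)
  map_mul _ _ := rfl
  map_star _ := rfl

theorem quotientHom_surjective (A : InvSemigroup) (c : Con A)
    (hc : ∀ x y, c x y → c (star x) (star y)) : (quotientHom A c hc).toFun.Surjective :=
  Quotient.mk_surjective

theorem quotientHom_eq_iff (A : InvSemigroup) (c : Con A)
    (hc : ∀ x y, c x y → c (star x) (star y)) (x y : A) :
    (quotientHom A c hc).toFun x = (quotientHom A c hc).toFun y ↔ c x y :=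
  c.eq

/-- The homomorphism from a quotient that is induced by a homomorphism. -/
def quotientLift {A B : InvSemigroup} (c : Con A) (hc : ∀ x y, c x y → c (star x) (star y))
    (f : Hom A B) (hf : ∀ x y, c x y → f.toFun x = f.toFun y) : Hom (quotient A c hc) B where
  toFun := Quotient.lift f.toFun hf
  map_mul a b := Con.induction_on₂ a b fun x y => f.map_mul x y
  map_star a := Con.induction_on a fun x => f.map_star x

/-- Birkhoff's theorem: a variety contains every algebra that satisfies its identities. -/
theorem IsVariety.mem_of_satisfies {V : Set InvSemigroup} (hV : IsVariety V) (A : InvSemigroup)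
    (hA : ∀ u v : Term A, (∀ B ∈ V, Satisfies B u v) → Satisfies A u v) : A ∈ V := by
  classical
  -- One witness per failing identity replaces the product over all of `V`: this index type is
  -- small, whereas `V` is a class in `Type 1`.
  let ι : Type := {p : Term A × Term A // ¬ ∀ B ∈ V, Satisfies B p.1 p.2}
  have h (p : ι) : ∃ B : InvSemigroup, B ∈ V ∧ ∃ θ : A → B, eval θ p.1.1 ≠ eval θ p.1.2 := by
    obtain ⟨p, hp⟩ := p
    simp only [Satisfies] at hp
    push Not at hp
    exact hp
  choose B hB θ hθ using h
  let Φ : Hom (free A) (pi B) :=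
    ⟨fun u p => eval (θ p) u, fun u v => funext fun p => map_mul (eval (θ p)) u v,
      fun u => funext fun p => eval_star (θ p) u⟩
  have hker (u v : Term A) (h : Φ.toFun u = Φ.toFun v) (C : InvSemigroup) (hC : C ∈ V) :
      Satisfies C u v := by
    by_contra hn
    exact hθ ⟨(u, v), fun h => hn (h C hC)⟩ (congrFun h _)
  let c : Con (free A) :=
    { r := fun u v => Φ.toFun u = Φ.toFun v
      iseqv := ⟨fun _ => rfl, fun h => h.symm, fun h h' => h.trans h'⟩
      mul' := fun h h' => by rw [Φ.map_mul, Φ.map_mul, h, h'] }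
  have hc : ∀ u v, c u v → c (star u) (star v) := fun u v h => by
    change Φ.toFun _ = Φ.toFun _
    rw [Φ.map_star, Φ.map_star]
    exact congrArg star h
  have hQ : quotient (free A) c hc ∈ V := by
    refine hV.sub _ (pi B) (quotientLift c hc Φ fun _ _ h => h) ?_ (hV.prod ι B hB)
    intro a b
    obtain ⟨u, rfl⟩ := quotientHom_surjective _ c hc a
    obtain ⟨v, rfl⟩ := quotientHom_surjective _ c hc b
    exact fun h => (quotientHom_eq_iff _ c hc u v).2 h
  -- With the elements of `A` as variables, the assignment `id` presents `A` as an image of the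
  -- relatively free algebra.
  refine hV.image _ A
    (quotientLift c hc (evalHom (A := A) id) fun u v h => hA u v (hker u v h) id) ?_ hQ
  intro a
  exact ⟨(quotientHom _ c hc).toFun (FreeSemigroup.of (a, false)), rfl⟩

/-- The terms in countably many variables suffice to determine a variety. -/
theorem IsVariety.mem_of_satisfies_nat {V : Set InvSemigroup} (hV : IsVariety V) (A : InvSemigroup)
    (hA : ∀ u v : Term ℕ, (∀ B ∈ V, Satisfies B u v) → Satisfies A u v) : A ∈ V := by
  refine hV.mem_of_satisfies A fun u v h θ => ?_
  have hfin (u : Term A) : ∃ s : Set A, s.Finite ∧ ∀ (B : InvSemigroup) (θ θ' : A → B),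
      (∀ x ∈ s, θ x = θ' x) → eval θ u = eval θ' u := by
    induction u using FreeSemigroup.recOnMul with
    | ih1 p =>
      refine ⟨{p.1}, Set.finite_singleton _, fun B θ θ' h => ?_⟩
      simp [eval_of, letterVal, h p.1]
    | ih2 p u h1 h2 =>
      obtain ⟨s, hs, h1⟩ := h1
      obtain ⟨t, ht, h2⟩ := h2
      refine ⟨s ∪ t, hs.union ht, fun B θ θ' h => ?_⟩
      rw [map_mul, map_mul, h1 B θ θ' fun x hx => h x (Or.inl hx),
        h2 B θ θ' fun x hx => h x (Or.inr hx)]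
  obtain ⟨s, hs, hu⟩ := hfin u
  obtain ⟨t, ht, hv⟩ := hfin v
  obtain ⟨f, hf⟩ := Set.countable_iff_exists_injOn.1 (hs.union ht).countable
  -- The finitely many variables of `u` and `v` are renamed injectively to natural numbers; `g`
  -- undoes the renaming on them.
  let φ : A → Term ℕ := fun x => FreeSemigroup.of (f x, false)
  let g : ℕ → A := Function.invFunOn f (s ∪ t)
  have hg : ∀ x ∈ s ∪ t, θ x = eval (θ ∘ g) (φ x) := fun x hx =>
    congrArg θ (hf.leftInvOn_invFunOn hx).symm
  rw [hu A θ _ fun x hx => hg x (Or.inl hx), hv A θ _ fun x hx => hg x (Or.inr hx),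
    ← eval_comp_eval, ← eval_comp_eval]
  refine hA _ _ (fun B hB θ' => ?_) _
  rw [eval_comp_eval, eval_comp_eval]
  exact h B hB _

instance countable_term : Countable (Term ℕ) :=
  Function.Injective.countable (f := fun u : Term ℕ => (u.head, u.tail)) fun _ _ h =>
    FreeSemigroup.ext (congrArg Prod.fst h) (congrArg Prod.snd h)

/-- There are at most continuum many varieties. -/
theorem mk_isVariety_le (V : Set InvSemigroup) :
    Cardinal.mk {W : Set InvSemigroup // IsVariety W ∧ W ⊆ V} ≤ Cardinal.continuum := by
  let F : {W : Set InvSemigroup // IsVariety W ∧ W ⊆ V} → ULift.{1} (Set (Term ℕ × Term ℕ)) :=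
    fun W => ⟨{p | ∀ B ∈ W.1, Satisfies B p.1 p.2}⟩
  have hsub (W W' : {W : Set InvSemigroup // IsVariety W ∧ W ⊆ V}) (h : F W = F W') :
      W.1 ⊆ W'.1 := fun A hA => W'.2.1.mem_of_satisfies_nat A fun u v huv => by
    have h1 : (u, v) ∈ (F W').down := huv
    rw [← h] at h1
    exact h1 A hA
  have hF : F.Injective := fun W W' h =>
    Subtype.ext ((hsub W W' h).antisymm (hsub W' W h.symm))
  refine (Cardinal.mk_le_of_injective hF).trans ?_
  rw [Cardinal.mk_uLift, Cardinal.lift_le_continuum, Cardinal.mk_set,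
    ← Cardinal.two_power_aleph0]
  exact Cardinal.power_le_power_left two_ne_zero Cardinal.mk_le_aleph0

/-- If algebras `A k` of `V` and identities are such that `A j` violates exactly the `j`-th
identity, then `V` has at least continuum many subvarieties. -/
theorem continuum_le_mk_isVariety {V : Set InvSemigroup} (hV : IsVariety V) (A : ℕ → InvSemigroup)
    (hA : ∀ k, A k ∈ V) (u v : ℕ → Term ℕ) (h : ∀ j k, Satisfies (A j) (u k) (v k) ↔ j ≠ k) :
    Cardinal.continuum ≤ Cardinal.mk {W : Set InvSemigroup // IsVariety W ∧ W ⊆ V} := by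
  -- The subvariety for `S` is cut out of `V` by the identities with index outside `S`, so that it
  -- contains exactly the `A j` with `j ∈ S`.
  let G (S : Set ℕ) : Set (Set InvSemigroup) :=
    insert V {W | ∃ k ∉ S, W = {B | Satisfies B (u k) (v k)}}
  have hG (S : Set ℕ) : IsVariety (⋂₀ G S) := IsVariety.sInter fun W hW => by
    rcases hW with rfl | ⟨k, -, rfl⟩
    exacts [hV, isVariety_satisfies _ _]
  have hmem (S : Set ℕ) (j : ℕ) : A j ∈ ⋂₀ G S ↔ j ∈ S := by
    constructor
    · intro hj
      by_contra hn
      exact (h j j).1 (hj _ (Or.inr ⟨j, hn, rfl⟩)) rfl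
    · rintro hj W (rfl | ⟨k, hk, rfl⟩)
      · exact hA j
      · exact (h j k).2 fun hjk => hk (hjk ▸ hj)
  let F : ULift.{1} (Set ℕ) → {W : Set InvSemigroup // IsVariety W ∧ W ⊆ V} :=
    fun S => ⟨⋂₀ G S.down, hG _, Set.sInter_subset_of_mem (Or.inl rfl)⟩
  have hF : F.Injective := fun S T hST => ULift.ext _ _ <| Set.ext fun j => by
    rw [← hmem, ← hmem]
    exact Eq.to_iff (congrArg (fun W : {W : Set InvSemigroup // IsVariety W ∧ W ⊆ V} =>
      A j ∈ W.1) hST)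
  refine le_trans ?_ (Cardinal.mk_le_of_injective hF)
  rw [Cardinal.mk_uLift, Cardinal.continuum_le_lift, Cardinal.mk_set, Cardinal.mk_nat,
    Cardinal.two_power_aleph0]

end InvSemigroup

/-! ### Combinatorics of the words `0 1 ⋯ (k-1) 0 (k-1) ⋯ 1` -/

namespace PairedWord

/-- Every position of the list has a different position with the same entry. -/
def Paired {α : Type} (L : List α) : Prop :=
  ∀ i < L.length, ∃ j < L.length, j ≠ i ∧ L[i]? = L[j]?

theorem Paired.map {α β : Type} {L : List α} (h : Paired L) (f : α → β) : Paired (L.map f) := by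
  intro i hi
  obtain ⟨j, hj, hji, hij⟩ := h i (by simpa using hi)
  exact ⟨j, by simpa using hj, hji, by simp [hij]⟩

theorem Paired.reverse {α : Type} {L : List α} (h : Paired L) : Paired L.reverse := by
  intro i hi
  rw [List.length_reverse] at hi
  obtain ⟨j, hj, hji, hij⟩ := h (L.length - 1 - i) (by omega)
  refine ⟨L.length - 1 - j, by rw [List.length_reverse]; omega, by omega, ?_⟩
  rw [List.getElem?_reverse hi, List.getElem?_reverse (by omega), hij]
  congr 1
  omega

theorem exists_split {α : Type} {L : List α} {i j : ℕ} {x : α} (hij : i < j)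
    (hi : L[i]? = some x) (hj : L[j]? = some x) :
    ∃ p q r : List α, L = p ++ x :: (q ++ x :: r) := by
  induction L generalizing i j with
  | nil => simp at hi
  | cons y L ih =>
    obtain ⟨j, rfl⟩ : ∃ m, j = m + 1 := ⟨j - 1, by omega⟩
    rw [List.getElem?_cons_succ] at hj
    cases i with
    | zero =>
      obtain ⟨q, r, rfl⟩ := List.append_of_mem (List.mem_of_getElem? hj)
      simp only [List.getElem?_cons_zero, Option.some.injEq] at hi
      exact ⟨[], q, r, by simp [hi]⟩
    | succ i =>
      obtain ⟨p, q, r, rfl⟩ := ih (i := i) (by omega) (by simpa using hi) hj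
      exact ⟨y :: p, q, r, rfl⟩

theorem Paired.exists_split {α : Type} {L : List α} (h : Paired L) {x : α} (hx : x ∈ L) :
    ∃ p q r : List α, L = p ++ x :: (q ++ x :: r) := by
  obtain ⟨i, hi, rfl⟩ := List.mem_iff_getElem.1 hx
  obtain ⟨j, hj, hji, hij⟩ := h i hi
  rw [List.getElem?_eq_getElem hi] at hij
  rcases lt_or_gt_of_ne hji with h | h
  · exact PairedWord.exists_split h hij.symm (List.getElem?_eq_getElem hi)
  · exact PairedWord.exists_split h (List.getElem?_eq_getElem hi) hij.symm

/-- The `i`-th letter of the word `0 1 ⋯ (k-1) 0 (k-1) ⋯ 1`. -/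
def letter (k i : ℕ) : ℕ := if i < k then i else if i = k then 0 else 2 * k - i

/-- The word `0 1 ⋯ (k-1) 0 (k-1) ⋯ 1`. -/
def word (k : ℕ) : List ℕ := (List.range (2 * k)).map (letter k)

theorem length_word (k : ℕ) : (word k).length = 2 * k := by simp [word]

theorem getElem?_word {k i : ℕ} (hi : i < 2 * k) : (word k)[i]? = some (letter k i) := by
  simp [word, hi]

theorem paired_word (k : ℕ) : Paired (word k) := by
  intro i hi
  rw [length_word] at hi
  -- Equal letters sit at positions `i` and `2 * k - i`, except that the two zeros are at `0` and
  -- `k`.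
  refine ⟨if i = 0 then k else if i = k then 0 else 2 * k - i, ?_, ?_, ?_⟩
  · rw [length_word]; grind
  · grind
  · rw [getElem?_word hi, getElem?_word (by grind)]
    simp only [letter]
    grind

/-- Each half of the word is free of repetitions. -/
theorem count_word_le (k x : ℕ) : (word k).count x ≤ 2 := by
  have h : word k = (List.range k).map (letter k) ++
      (List.range k).map (fun i => letter k (k + i)) := by
    rw [word, two_mul, List.range_add, List.map_append, List.map_map]
    rfl
  have h1 : ((List.range k).map (letter k)).Nodup := by
    refine List.Nodup.map_on (fun i hi j hj hij => ?_) List.nodup_range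
    simp only [List.mem_range, letter] at hi hj hij
    grind
  have h2 : ((List.range k).map (fun i => letter k (k + i))).Nodup := by
    refine List.Nodup.map_on (fun i hi j hj hij => ?_) List.nodup_range
    simp only [List.mem_range, letter] at hi hj hij
    grind
  rw [h, List.count_append]
  have := List.nodup_iff_count_le_one.1 h1 x
  have := List.nodup_iff_count_le_one.1 h2 x
  omega

/-- The word has no two disjoint occurrences of a factor of length two. -/
theorem word_ne_repeat {k : ℕ} (hk : 3 ≤ k) (p q r : List ℕ) (c d : ℕ) :
    word k ≠ p ++ c :: d :: (q ++ c :: d :: r) := by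
  intro h
  have hl := congrArg List.length h
  rw [length_word] at hl
  simp only [List.length_append, List.length_cons] at hl
  have h1 := getElem?_word (k := k) (i := p.length) (by omega)
  have h2 := getElem?_word (k := k) (i := p.length + 1) (by omega)
  have h3 := getElem?_word (k := k) (i := p.length + (q.length + 2)) (by omega)
  have h4 := getElem?_word (k := k) (i := p.length + (q.length + 3)) (by omega)
  rw [h, List.getElem?_append_right (by omega)] at h1 h2 h3 h4
  simp only [Nat.sub_self, Nat.add_sub_cancel_left, List.getElem?_cons_zero,
    List.getElem?_cons_succ] at h1 h2 h3 h4
  rw [List.getElem?_append_right (by omega)] at h3 h4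
  simp only [Nat.sub_self, Nat.add_sub_cancel_left, List.getElem?_cons_zero,
    List.getElem?_cons_succ, Option.some.injEq] at h1 h2 h3 h4
  -- Here `3 ≤ k` matters: for `k = 2` the word is `0 1 0 1`.
  simp only [letter] at *
  grind

/-- No proper nonempty factor of the word is paired. -/
theorem Paired.length_eq {k : ℕ} {M : List ℕ} (hM : Paired M) (hne : M ≠ [])
    (h : M <:+: word k) : M.length = 2 * k := by
  obtain ⟨p, s, h⟩ := h
  have hl := congrArg List.length h
  rw [length_word] at hl
  simp only [List.length_append] at hl
  have hpos := List.length_pos_iff.2 hne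
  have hget (i : ℕ) (hi : i < M.length) : M[i]? = some (letter k (p.length + i)) := by
    rw [← getElem?_word (by omega), ← h, List.append_assoc,
      List.getElem?_append_right (by omega), List.getElem?_append_left (by omega)]
    congr 1
    omega
  have hpair (i : ℕ) (h1 : p.length ≤ i) (h2 : i < p.length + M.length) :
      ∃ j, p.length ≤ j ∧ j < p.length + M.length ∧ j ≠ i ∧ letter k i = letter k j := by
    obtain ⟨j, hj, hji, hij⟩ := hM (i - p.length) (by omega)
    rw [hget _ (by omega), hget _ hj, Option.some.injEq, Nat.add_sub_cancel' h1] at hij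
    exact ⟨p.length + j, by omega, by omega, by omega, hij⟩
  simp only [letter] at hpair
  -- A factor starting at a position `i` with `0 < i < k` must contain the partner `2 * k - i`,
  -- hence position `k`, whose partner `0` is missed. Starting at `k` or later, the first letter has
  -- its partner to the left.
  have h0 : p.length = 0 := by
    by_contra h0
    obtain ⟨j, hj⟩ := hpair p.length le_rfl (by omega)
    by_cases hk : p.length < k
    · obtain ⟨i, hi⟩ := hpair k (by omega) (by grind)
      grind
    · grind
  -- Starting at `0`, the factor contains position `k`; for `k ≠ 1` it then contains position `1`,
  -- hence its partner `2 * k - 1`, the last position.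
  obtain ⟨j, hj⟩ := hpair 0 (by omega) (by omega)
  by_cases hk : k = 1
  · grind
  · obtain ⟨i, hi⟩ := hpair 1 (by omega) (by grind)
    grind

/-- A word that is obtained from a paired word by substituting nonempty words for letters is not
a factor of `word k`, except possibly if the length of the paired word is `2 * k`. -/
theorem Paired.length_eq_of_flatMap {α : Type} {k : ℕ} (hk : 3 ≤ k) {W : List α} (hW : Paired W)
    (hne : W ≠ []) (f : α → List ℕ) (hf : ∀ x, f x ≠ []) (h : W.flatMap f <:+: word k) :
    W.length = 2 * k := by
  have h1 : ∀ x ∈ W, f x = [(f x).head (hf x)] := by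
    intro x hx
    obtain ⟨p, q, r, rfl⟩ := hW.exists_split hx
    obtain ⟨s, t, h⟩ := h
    -- If `f x` began with two letters `c d`, the two occurrences of `x` would give disjoint
    -- occurrences of `c d`.
    have hcases : (∃ c, f x = [c]) ∨ ∃ c d l, f x = c :: d :: l := by
      have hfx := hf x
      revert hfx
      rcases f x with _ | ⟨c, _ | ⟨d, l⟩⟩ <;> simp
    obtain ⟨c, hc⟩ | ⟨c, d, l, hfx⟩ := hcases
    · simp [hc]
    · refine absurd h.symm ?_
      have := word_ne_repeat hk (s ++ p.flatMap f) (l ++ q.flatMap f) (l ++ r.flatMap f ++ t) c d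
      simpa [hfx] using this
  have h2 : W.flatMap f = W.map fun x => (f x).head (hf x) := by
    rw [List.map_eq_flatMap]
    exact List.flatMap_congr h1
  rw [h2] at h
  simpa using (hW.map _).length_eq (by simpa using hne) h

end PairedWord

/-! ### Recovering a word from twin search trees -/

namespace Baxter

/-- The multiset of labels of a tree. -/
def labels {α : Type} : BinaryTree α → Multiset α
  | .nil => 0
  | .node x l r => x ::ₘ (labels l + labels r)

theorem labels_rightStrictInsert {α : Type} [LinearOrder α] (a : α) (T : BinaryTree α) :
    labels (rightStrictInsert a T) = a ::ₘ labels T := by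
  induction T with
  | nil => rfl
  | node x l r ihl ihr =>
    by_cases h : x < a <;> simp [rightStrictInsert, labels, h, ihl, ihr, Multiset.cons_swap a x]

theorem labels_rightTree {α : Type} [LinearOrder α] (w : List α) :
    labels (rightTree w) = w := by
  induction w with
  | nil => rfl
  | cons a w ih =>
    change labels (rightStrictInsert a (rightTree w)) = _
    rw [labels_rightStrictInsert, ih, Multiset.cons_coe]

theorem perm_of_twinTrees_eq {α : Type} [LinearOrder α] {u v : List α}
    (h : twinTrees u = twinTrees v) : u.Perm v := by
  rw [← Multiset.coe_eq_coe, ← labels_rightTree, ← labels_rightTree]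
  exact congrArg (fun T => labels T.2) h

theorem map_rightStrictInsert {α β : Type} [LinearOrder α] [LinearOrder β] {f : α → β}
    (hf : StrictMono f) (a : α) (T : BinaryTree α) :
    (rightStrictInsert a T).map f = rightStrictInsert (f a) (T.map f) := by
  induction T with
  | nil => rfl
  | node x l r ihl ihr =>
    by_cases h : x < a <;> simp [rightStrictInsert, BinaryTree.map, hf.lt_iff_lt, h, ihl, ihr]

theorem map_leftStrictInsert {α β : Type} [LinearOrder α] [LinearOrder β] {f : α → β}
    (hf : StrictMono f) (a : α) (T : BinaryTree α) :
    (leftStrictInsert a T).map f = leftStrictInsert (f a) (T.map f) := by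
  induction T with
  | nil => rfl
  | node x l r ihl ihr =>
    by_cases h : a < x <;> simp [leftStrictInsert, BinaryTree.map, hf.lt_iff_lt, h, ihl, ihr]

theorem rightTree_map {α β : Type} [LinearOrder α] [LinearOrder β] {f : α → β}
    (hf : StrictMono f) (w : List α) : rightTree (w.map f) = (rightTree w).map f := by
  induction w with
  | nil => rfl
  | cons a w ih =>
    change rightStrictInsert (f a) (rightTree (w.map f)) = (rightStrictInsert a (rightTree w)).map f
    rw [ih, map_rightStrictInsert hf]

theorem leftTree_map {α β : Type} [LinearOrder α] [LinearOrder β] {f : α → β}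
    (hf : StrictMono f) (w : List α) : leftTree (w.map f) = (leftTree w).map f := by
  induction w using List.reverseRecOn with
  | nil => rfl
  | append_singleton w a ih =>
    simp only [leftTree, List.map_append, List.map_cons, List.map_nil, List.foldl_append,
      List.foldl_cons, List.foldl_nil] at ih ⊢
    rw [ih, map_leftStrictInsert hf]

theorem map_tree_injective {α β : Type} {f : α → β} (hf : f.Injective) :
    Function.Injective (BinaryTree.map f) := by
  intro S T h
  induction S generalizing T with
  | nil => cases T <;> simp_all [BinaryTree.map]
  | node x l r ihl ihr =>
    cases T with
    | nil => simp [BinaryTree.map] at h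
    | node y l' r' =>
      simp only [BinaryTree.map, BinaryTree.node.injEq] at h
      rw [hf h.1, ihl h.2.1, ihr h.2.2]

/-- Insertion only compares labels, so two-letter words can be studied over `Bool` and transported
to any pair of letters of `Fin n`. -/
theorem twinTrees_map_iff {α β : Type} [LinearOrder α] [LinearOrder β] {f : α → β}
    (hf : StrictMono f) (u v : List α) :
    twinTrees (u.map f) = twinTrees (v.map f) ↔ twinTrees u = twinTrees v := by
  simp only [twinTrees, leftTree_map hf, rightTree_map hf, Prod.mk.injEq,
    (map_tree_injective hf.injective).eq_iff]

/-- The binary words of a given length. -/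
def boolWords : ℕ → List (List Bool)
  | 0 => [[]]
  | m + 1 => (boolWords m).map (List.cons false) ++ (boolWords m).map (List.cons true)

theorem mem_boolWords (w : List Bool) : w ∈ boolWords w.length := by
  induction w with
  | nil => simp [boolWords]
  | cons b w ih => cases b <;> simp [boolWords, ih]

/-- A finite check, as such words have length at most four. Both orders are needed: for `a < b` the
words `bbaa` and `baba` have the same twin trees. -/
theorem eq_of_twinTrees_boolWords : ∀ m ∈ List.range 5, ∀ u ∈ boolWords m, ∀ v ∈ boolWords m,
    u.count false ≤ 2 → u.count true ≤ 2 → twinTrees u = twinTrees v →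
      twinTrees (u.map not) = twinTrees (v.map not) → u = v := by
  decide +kernel

/-- Binary words in which both letters occur at most twice are determined by their twin search
trees with respect to both orders of the alphabet. -/
theorem eq_of_twinTrees_bool {u v : List Bool} (h0 : u.count false ≤ 2) (h1 : u.count true ≤ 2)
    (h : twinTrees u = twinTrees v) (h' : twinTrees (u.map not) = twinTrees (v.map not)) :
    u = v := by
  have hl : v.length = u.length := (perm_of_twinTrees_eq h).length_eq.symm
  have h5 : u.length ∈ List.range 5 := by
    have := List.count_false_add_count_true u
    rw [List.mem_range]
    omega
  exact eq_of_twinTrees_boolWords _ h5 u (mem_boolWords u) v (hl ▸ mem_boolWords v) h0 h1 h h'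

/-- The image of a word under the deletion of all letters but two, which are renamed. -/
def select (x y z : ℕ) : List Bool := if z = x then [false] else if z = y then [true] else []

theorem count_flatMap_select {x y : ℕ} (hxy : x ≠ y) (u : List ℕ) :
    (u.flatMap (select x y)).count false = u.count x ∧
      (u.flatMap (select x y)).count true = u.count y := by
  induction u with
  | nil => simp
  | cons z u ih =>
    by_cases hx : z = x
    · subst hx; simp [select, ih, hxy]
    · by_cases hy : z = y
      · subst hy; simp [select, ih, hx]
      · simp [select, ih, hx, hy]

/-- Exchanging the two selected letters amounts to reversing the order of the binary alphabet. -/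
theorem flatMap_select_map_not {x y : ℕ} (hxy : x ≠ y) (u : List ℕ) :
    (u.flatMap (select x y)).map not = u.flatMap (select y x) := by
  induction u with
  | nil => rfl
  | cons z u ih =>
    rw [List.flatMap_cons, List.flatMap_cons, List.map_append, ih]
    congr 1
    simp only [select]
    split_ifs <;> simp_all

/-- If the first letters `a` and `b` differ, the projection to these two letters already detects it;
otherwise they cancel. -/
theorem eq_of_flatMap_select {u v : List ℕ}
    (h : ∀ x y, x ≠ y → u.flatMap (select x y) = v.flatMap (select x y)) : u = v := by
  induction u generalizing v with
  | nil =>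
    cases v with
    | nil => rfl
    -- Any letter other than `b` would do in place of `b + 1`.
    | cons b v => simpa [select] using h b (b + 1) (by simp)
  | cons a u ih =>
    cases v with
    | nil => simpa [select] using h a (a + 1) (by simp)
    | cons b v =>
      by_cases hab : a = b
      · subst hab
        rw [ih fun x y hxy => List.append_cancel_left (h x y hxy)]
      · simpa [select, Ne.symm hab] using h a b hab

end Baxter

/-! ### Terms as lists of letters -/

namespace InvSemigroup

/-- The list of letters of a term. -/
def letters {X : Type} (u : Term X) : List (X × Bool) := u.head :: u.tail

theorem letters_of {X : Type} (p : X × Bool) :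
    letters (FreeSemigroup.of p : Term X) = [p] := rfl

theorem letters_mul {X : Type} (u v : Term X) : letters (u * v) = letters u ++ letters v := rfl

theorem letters_injective {X : Type} : Function.Injective (letters (X := X)) := fun u v h => by
  simp only [letters, List.cons.injEq] at h
  exact FreeSemigroup.ext h.1 h.2

theorem letters_star {X : Type} (u : Term X) :
    letters (star u) = (letters u).reverse.map starLetter := by
  induction u using FreeSemigroup.recOnMul with
  | ih1 p => rfl
  | ih2 p u h1 h2 => rw [star_mul, letters_mul, letters_mul, h1, h2]; simp

theorem letters_eval {X Y : Type} [Nonempty Y] (φ : X → Term Y) (u : Term X) :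
    letters (eval (A := free Y) φ u : Term Y) =
      (letters u).flatMap fun p => letters (letterVal (A := free Y) φ p : Term Y) := by
  induction u using FreeSemigroup.recOnMul with
  | ih1 p => exact (List.flatMap_singleton ..).symm
  | ih2 p u h1 h2 =>
    rw [letters_mul, List.flatMap_append, ← h1, ← h2, map_mul]
    rfl

end InvSemigroup

/-! ### Isoterms for the Baxter monoid -/

namespace Baxter

open InvSemigroup

/-- The class of a word in the Baxter monoid. -/
def toBaxt {n : ℕ} (w : List (Fin n)) : baxt n := ((FreeMonoid.ofList w : FreeMonoid (Fin n)) :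
  BaxterMonoid n)

theorem toBaxt_eq_iff {n : ℕ} (u v : List (Fin n)) :
    toBaxt u = toBaxt v ↔ twinTrees u = twinTrees v :=
  (con n).eq

theorem eval_toBaxt {X : Type} {n : ℕ} (g : X → List (Fin n)) (u : Term X) :
    eval (fun x => toBaxt (g x)) u =
      toBaxt ((letters u).flatMap fun p => if p.2 then sharp (g p.1) else g p.1) := by
  have h (p : X × Bool) : letterVal (fun x => toBaxt (g x)) p =
      toBaxt (if p.2 then sharp (g p.1) else g p.1) := by
    rcases p with ⟨x, _ | _⟩ <;> rfl
  induction u using FreeSemigroup.recOnMul with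
  | ih1 p => rw [eval_of, letters_of, List.flatMap_singleton, h]
  | ih2 p u h1 h2 => rw [map_mul, h1, h2, letters_mul, List.flatMap_append]; rfl

theorem twinTrees_of_satisfies {X : Type} {n : ℕ} {u v : Term X} (h : Satisfies (baxt n) u v)
    (g : X → List (Fin n)) :
    twinTrees ((letters u).flatMap fun p => if p.2 then sharp (g p.1) else g p.1) =
      twinTrees ((letters v).flatMap fun p => if p.2 then sharp (g p.1) else g p.1) := by
  rw [← toBaxt_eq_iff, ← eval_toBaxt, ← eval_toBaxt, h]

/-- Words without stars in which each letter occurs at most twice are isoterms for the Baxter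
monoid with Schützenberger's involution. -/
theorem eq_of_satisfies {n : ℕ} (hn : 2 ≤ n) {u v : Term ℕ} {l : List ℕ}
    (hu : letters u = l.map fun x => (x, false)) (hl : ∀ x, l.count x ≤ 2)
    (h : Satisfies (baxt n) u v) : u = v := by
  -- The least and the greatest letter, which the involution exchanges.
  let a : Fin n := ⟨0, by omega⟩
  let b : Fin n := ⟨n - 1, by omega⟩
  have hab : a < b := Fin.mk_lt_mk.2 (by omega)
  have hrev : a.rev = b := Fin.ext (by simp [a, b])
  -- Send `x` to `a` and all other variables to the empty word: a starred `x` in `v` would produce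
  -- `b`, while the star-free `u` produces only `a`.
  have hstar (x : ℕ) : (x, true) ∉ letters v := by
    intro hx
    have h1 := (perm_of_twinTrees_eq
      (twinTrees_of_satisfies h fun y => if y = x then [a] else [])).mem_iff (a := b)
    have h2 := h1.2 (List.mem_flatMap.2 ⟨_, hx, by simp [sharp, hrev]⟩)
    rw [hu] at h2
    simp only [List.mem_flatMap, List.mem_map] at h2
    obtain ⟨_, ⟨y, -, rfl⟩, h2⟩ := h2
    by_cases hy : y = x <;> simp [hy, hab.ne'] at h2
  obtain ⟨l', hv⟩ : ∃ l' : List ℕ, letters v = l'.map fun x => (x, false) := by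
    refine ⟨(letters v).map Prod.fst, ?_⟩
    rw [List.map_map]
    refine (List.map_id _).symm.trans (List.map_congr_left fun p hp => ?_)
    obtain ⟨x, _ | _⟩ := p
    exacts [rfl, absurd hp (hstar x)]
  have hsel (x y : ℕ) : twinTrees (l.flatMap (select x y)) = twinTrees (l'.flatMap (select x y)) := by
    let e : Bool → Fin n := fun c => if c then b else a
    have he : StrictMono e := by
      rintro (_ | _) (_ | _) hcd <;> first | exact hab | exact absurd hcd (by decide)
    -- Since `baxt n` has an identity element, unselected variables can be erased.
    have h1 := twinTrees_of_satisfies h fun z => (select x y z).map e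
    rw [← twinTrees_map_iff he]
    simpa [hu, hv, List.flatMap_map, List.map_flatMap] using h1
  refine letters_injective ?_
  rw [hu, hv]
  congr 1
  refine eq_of_flatMap_select fun x y hxy => ?_
  have hc := count_flatMap_select hxy l
  refine eq_of_twinTrees_bool (hc.1 ▸ hl x) (hc.2 ▸ hl y) (hsel x y) ?_
  rw [flatMap_select_map_not hxy, flatMap_select_map_not hxy]
  exact hsel y x

end Baxter

/-! ### The Rees quotients and their independent identities -/

namespace InvSemigroup

open PairedWord

/-- The word `0 1 ⋯ (k-1) 0 (k-1) ⋯ 1` as a term. -/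
def wordTerm (k : ℕ) : Term ℕ := ⟨(0, false), (word k).tail.map fun x => (x, false)⟩

theorem letters_wordTerm {k : ℕ} (hk : 0 < k) :
    letters (wordTerm k) = (word k).map fun x => (x, false) := by
  obtain ⟨m, rfl⟩ := Nat.exists_eq_succ_of_ne_zero hk.ne'
  simp [letters, wordTerm, word, letter, mul_add, List.range_succ_eq_map]

/-- The term or its star is a factor of `wordTerm k`. -/
def IsFactor (k : ℕ) (u : Term ℕ) : Prop :=
  letters u <:+: letters (wordTerm k) ∨ letters (star u) <:+: letters (wordTerm k)

theorem IsFactor.star {k : ℕ} {u : Term ℕ} (h : IsFactor k u) : IsFactor k (star u) := by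
  rw [IsFactor, star_star]
  exact h.symm

theorem IsFactor.of_mul_left {k : ℕ} {u v : Term ℕ} (h : IsFactor k (u * v)) : IsFactor k u := by
  rw [IsFactor, star_mul, letters_mul, letters_mul] at h
  exact h.imp (List.infix_append_left.trans ·) (List.infix_append_right.trans ·)

theorem IsFactor.of_mul_right {k : ℕ} {u v : Term ℕ} (h : IsFactor k (u * v)) : IsFactor k v := by
  rw [IsFactor, star_mul, letters_mul, letters_mul] at h
  exact h.imp (List.infix_append_right.trans ·) (List.infix_append_left.trans ·)

/-- The congruence on the free involution semigroup that identifies all words that are neither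
factors of `wordTerm k` nor of its star. -/
def reesCon (k : ℕ) : Con (free ℕ) where
  r u v := u = v ∨ ¬ IsFactor k u ∧ ¬ IsFactor k v
  iseqv := ⟨fun _ => Or.inl rfl, fun h => h.imp Eq.symm And.symm, by
    rintro u v w (rfl | h) (rfl | h')
    exacts [Or.inl rfl, Or.inr h', Or.inr h, Or.inr ⟨h.1, h'.2⟩]⟩
  mul' := by
    rintro u v u' v' (rfl | h) (rfl | h')
    exacts [Or.inl rfl, Or.inr ⟨fun h => h'.1 h.of_mul_right, fun h => h'.2 h.of_mul_right⟩,
      Or.inr ⟨fun h' => h.1 h'.of_mul_left, fun h' => h.2 h'.of_mul_left⟩,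
      Or.inr ⟨fun h' => h.1 h'.of_mul_left, fun h' => h.2 h'.of_mul_left⟩]

theorem reesCon_star (k : ℕ) (u v : free ℕ) (h : reesCon k u v) :
    reesCon k (star u) (star v) := by
  rcases h with rfl | h
  · exact Or.inl rfl
  · refine Or.inr ⟨fun h' => h.1 ?_, fun h' => h.2 ?_⟩
    · rw [← star_star u]; exact h'.star
    · rw [← star_star v]; exact h'.star

/-- The Rees quotient of the free involution semigroup that consists of the factors of `wordTerm k`
and of its star, and of a zero. -/
def rees (k : ℕ) : InvSemigroup := quotient (free ℕ) (reesCon k) (reesCon_star k)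

/-- An identity holds in `rees k` if and only if all its substitution instances in the free
involution semigroup are trivial or have both sides zero in `rees k`. -/
theorem satisfies_rees_iff {X : Type} (k : ℕ) (u v : Term X) :
    Satisfies (rees k) u v ↔ ∀ φ : X → Term ℕ,
      reesCon k (eval (A := free ℕ) φ u) (eval (A := free ℕ) φ v) := by
  let π := quotientHom (free ℕ) (reesCon k) (reesCon_star k)
  constructor
  · intro h φ
    have h1 := h (π.toFun ∘ φ)
    rw [← quotientHom_eq_iff _ _ (reesCon_star k), Hom.eval, Hom.eval]
    exact h1
  · intro h θ
    have hπ := quotientHom_surjective (free ℕ) (reesCon k) (reesCon_star k)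
    have hθ : π.toFun ∘ (fun x => (hπ (θ x)).choose) = θ := funext fun x => (hπ (θ x)).choose_spec
    have h1 := h fun x => (hπ (θ x)).choose
    rw [← quotientHom_eq_iff _ _ (reesCon_star k), Hom.eval, Hom.eval] at h1
    rw [hθ] at h1
    exact h1

theorem eq_of_satisfies_of_isFactor {n k : ℕ} (hn : 2 ≤ n) (hk : 0 < k) {u v : Term ℕ}
    (hu : IsFactor k u) (h : Satisfies (baxt n) u v) : u = v := by
  have key (u v : Term ℕ) (hu : letters u <:+: letters (wordTerm k))
      (h : Satisfies (baxt n) u v) : u = v := by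
    rw [letters_wordTerm hk, List.infix_map_iff] at hu
    obtain ⟨l, hl, hu⟩ := hu
    exact Baxter.eq_of_satisfies hn hu
      (fun x => (hl.sublist.count_le x).trans (count_word_le k x)) h
  rcases hu with hu | hu
  · exact key u v hu h
  · refine star_injective (key _ _ hu fun θ => ?_)
    rw [eval_star, eval_star, h]

/-- Substitution instances of identities of `baxt n` are again identities of `baxt n`. If one side
is nonzero in `rees k`, it is an isoterm and the instance is trivial; otherwise both sides are zero.
-/
theorem rees_mem_generatedVariety {n k : ℕ} (hn : 2 ≤ n) (hk : 0 < k) :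
    rees k ∈ generatedVariety (baxt n) := by
  refine (isVariety_generatedVariety _).mem_of_satisfies _ fun u v h => ?_
  rw [satisfies_rees_iff]
  intro φ
  have huv : Satisfies (baxt n) (eval (A := free ℕ) φ u : Term ℕ)
      (eval (A := free ℕ) φ v : Term ℕ) := fun θ => by
    rw [eval_comp_eval, eval_comp_eval]
    exact h _ (mem_generatedVariety _) _
  by_cases hu : IsFactor k (eval (A := free ℕ) φ u)
  · exact Or.inl (eq_of_satisfies_of_isFactor hn hk hu huv)
  · by_cases hv : IsFactor k (eval (A := free ℕ) φ v)
    · exact Or.inl (eq_of_satisfies_of_isFactor hn hk hv fun θ => (huv θ).symm).symm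
    · exact Or.inr ⟨hu, hv⟩

theorem length_letters_eq_of_infix {k : ℕ} (hk : 3 ≤ k) {X : Type} {W : List X} (hW : Paired W)
    (hne : W ≠ []) (f : X → Term ℕ)
    (h : W.flatMap (fun x => letters (f x)) <:+: letters (wordTerm k)) :
    W.length = 2 * k := by
  -- All letters of `wordTerm k` are unstarred, so the star marks can be forgotten.
  refine hW.length_eq_of_flatMap hk hne (fun x => (letters (f x)).map Prod.fst)
    (fun x => by simp [letters]) ?_
  rw [letters_wordTerm (by omega)] at h
  simpa [List.map_flatMap, Function.comp_def] using h.map Prod.fst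

theorem not_isFactor_eval_wordTerm {j k : ℕ} (hj : 3 ≤ j) (hk : 3 ≤ k) (hjk : j ≠ k)
    (φ : ℕ → Term ℕ) : ¬ IsFactor j (eval (A := free ℕ) φ (wordTerm k)) := by
  have hp : Paired (letters (wordTerm k)) := by
    rw [letters_wordTerm (by omega)]
    exact (paired_word k).map _
  have hl : (letters (wordTerm k)).length = 2 * k := by
    rw [letters_wordTerm (by omega), List.length_map, length_word]
  rintro (h | h)
  · rw [letters_eval] at h
    have := length_letters_eq_of_infix hj hp (by simp [letters]) _ h
    omega
  · have hs : letters (star (wordTerm k)) ≠ [] := by simp [letters]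
    -- The star is moved inside the substitution: the starred word is again paired and has the same
    -- length.
    rw [← eval_star (A := free ℕ), letters_eval] at h
    have h2 := length_letters_eq_of_infix hj
      (by rw [letters_star]; exact hp.reverse.map _) hs _ h
    rw [letters_star, List.length_map, List.length_reverse] at h2
    omega

/-- For `j ≠ k` every instance of either side is zero. For `j = k` the identity substitution gives a
nonzero left side, which differs in length from its square. -/
theorem satisfies_rees_wordTerm_iff {j k : ℕ} (hj : 3 ≤ j) (hk : 3 ≤ k) :
    Satisfies (rees j) (wordTerm k) (wordTerm k * wordTerm k) ↔ j ≠ k := by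
  rw [satisfies_rees_iff]
  constructor
  · rintro h rfl
    have hid : eval (A := free ℕ) (fun x => FreeSemigroup.of (x, false)) (wordTerm j) =
        wordTerm j := by
      refine letters_injective ?_
      rw [letters_eval, letters_wordTerm (by omega), List.flatMap_map]
      exact List.map_eq_flatMap.symm
    have h1 := h fun x => FreeSemigroup.of (x, false)
    rw [map_mul, hid] at h1
    rcases h1 with h1 | h1
    · have h2 := congrArg FreeSemigroup.length h1
      rw [FreeSemigroup.length_mul] at h2
      simp [FreeSemigroup.length] at h2
    · exact h1.1 (Or.inl List.infix_rfl)
  · intro hjk φ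
    have h1 := not_isFactor_eval_wordTerm hj hk hjk φ
    refine Or.inr ⟨h1, fun h => h1 ?_⟩
    rw [map_mul] at h
    exact IsFactor.of_mul_left h

end InvSemigroup

theorem mainTheorem11 (n : ℕ) (hn : 2 ≤ n) :
    Cardinal.mk {V : Set InvSemigroup //
      InvSemigroup.IsVariety V ∧ V ⊆ InvSemigroup.generatedVariety (baxt n)} =
    Cardinal.continuum :=
  (InvSemigroup.mk_isVariety_le _).antisymm <|
    InvSemigroup.continuum_le_mk_isVariety (InvSemigroup.isVariety_generatedVariety _)
      -- The shift by three ensures that no factor of length two repeats in the words.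
      (fun k => InvSemigroup.rees (k + 3))
      (fun _ => InvSemigroup.rees_mem_generatedVariety hn (by omega)) _ _ fun j k =>
        (InvSemigroup.satisfies_rees_wordTerm_iff (j := j + 3) (k := k + 3) (by omega)
          (by omega)).trans (by omega)
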